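/- Let $H$ be a complex Hilbert space, let $n\in\mathbb N$, and let $\varphi\colon B(H)\to M_n=M_n(\mathbb C)$ be a positive linear map which is normal (weakly continuous on bounded sets) and nondecomposable, i.e. $\varphi$ is not of the form $\varphi_1+\varphi_2$ with $\varphi_1\colon B(H)\to M_n$ completely positive and $\varphi_2\colon B(H)\to M_n$ copositive (that is, $t\circ\varphi_2$ is completely positive, where $t$ is the transpose map of $M_n$). Then there is a normal state $\rho$ on $B(H)\otimes M_n = M_n(B(H)) = B(H\otimes\mathbb C^n)$ with a density operator $h$, i.e. a positive trace class operator $h=(h_{ij})$ with $\rho(x)=\mathrm{Tr}(hx)$ for all $x\in B(H)\otimes M_n$, such that * $h$ has positive partial transpose: applying the transpose map to the factor $M_n$ and the identity to the factor $B(H)$ gives a positive operator $(h_{ji})_{ij}\ge 0$, and likewise applying the identity to $M_n$ and the transpose map of $B(H)$ with respect to an arbitrary orthonormal basis of $H$ to $B(H)$ gives a positive operator; * applying $\varphi$ to the factor $B(H)$ and the identity to the factor $M_n$ gives a matrix $(\varphi(h_{ij}))_{ij}\in M_n\otimes M_n$ that is not positive. Moreover $\rho$ is entangled, i.e. it does not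 belong to the norm closure, in the dual of $B(H)\otimes M_n$, of the set of finite sums $\sum_k c_k\,\sigma_k\otimes\omega_k$ with $c_k\ge 0$, $\sigma_k$ a state of $B(H)$ and $\omega_k$ a state of $M_n$; and $\rho$ satisfies the Peres condition, i.e. $\rho\circ(\iota\otimes t)$ is positive on $B(H)\otimes M_n$, where $\iota$ is the identity map of $B(H)$ and $t$ is the transpose map of $M_n$. -/

import Mathlib

open scoped ComplexOrder CStarAlgebra InnerProductSpace NNReal

noncomputable section

namespace SepStates

/-- `M_n`, the C⋆-algebra of complex `n × n` matrices. -/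
abbrev Mat (n : ℕ) : Type := CStarMatrix (Fin n) (Fin n) ℂ

/-- `B(H) ⊗ M_n`, as the C⋆-algebra of `n × n` matrices over `B(H)`, that is `B(H ⊗ ℂⁿ)`. -/
abbrev BTensorMat (H : Type*) [NormedAddCommGroup H] [InnerProductSpace ℂ H] [CompleteSpace H]
    (n : ℕ) : Type _ :=
  CStarMatrix (Fin n) (Fin n) (H →L[ℂ] H)

section CStar

variable {A : Type*} [CStarAlgebra A] [PartialOrder A] [StarOrderedRing A]

/-- A state: a bounded linear functional which is positive and takes the value `1` at `1`. -/
def IsState (ρ : StrongDual ℂ A) : Prop :=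
  (∀ x : A, 0 ≤ x → 0 ≤ ρ x) ∧ ρ 1 = 1

/-- A linear map `A → M_n` is completely positive. -/
def IsCompletelyPositive {n : ℕ} (φ : A →ₗ[ℂ] Mat n) : Prop :=
  ∃ F : A →CP Mat n, F.toLinearMap = φ

/-- The transpose map on `M_n`. -/
def transposeMat (n : ℕ) : Mat n →ₗ[ℂ] Mat n where
  toFun x := x.transpose
  map_add' _ _ := rfl
  map_smul' _ _ := rfl

/-- A linear map `φ : A → M_n` is copositive if `t ∘ φ` is completely positive. -/
def IsCopositive {n : ℕ} (φ : A →ₗ[ℂ] Mat n) : Prop :=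
  IsCompletelyPositive (transposeMat n ∘ₗ φ)

/-- A linear map is decomposable if it is the sum of a completely positive map and a copositive
map. -/
def IsDecomposable {n : ℕ} (φ : A →ₗ[ℂ] Mat n) : Prop :=
  ∃ φ₁ φ₂ : A →ₗ[ℂ] Mat n, IsCompletelyPositive φ₁ ∧ IsCopositive φ₂ ∧ φ = φ₁ + φ₂

end CStar

section Hilbert

variable {H : Type*} [NormedAddCommGroup H] [InnerProductSpace ℂ H] [CompleteSpace H] {n : ℕ}

/-- A map `φ : B(H) → M_n` is normal: it is weakly continuous on bounded sets. (`H →WOT[ℂ] H` is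
`B(H)` with the weak operator topology; on `M_n` all the usual topologies agree.) -/
def IsNormalMap (φ : (H →L[ℂ] H) → Mat n) : Prop :=
  ∀ r : ℝ, ContinuousOn (fun T : H →WOT[ℂ] H => φ T.toCLM) {T | ‖T.toCLM‖ ≤ r}

/-- The operator matrix with entries `X i j`, each entry being taken with its weak operator
topology. The weak operator topology of `B(H ⊗ ℂⁿ)` is the product topology on these matrices. -/
def ofWOT (X : Matrix (Fin n) (Fin n) (H →WOT[ℂ] H)) : BTensorMat H n :=
  CStarMatrix.ofMatrix (X.map fun T => T.toCLM)

/-- A functional on `B(H) ⊗ M_n = B(H ⊗ ℂⁿ)` is normal: it is weakly continuous on bounded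
sets. -/
def IsNormalFunctional (ρ : StrongDual ℂ (BTensorMat H n)) : Prop :=
  ∀ r : ℝ, ContinuousOn
    (fun X : Matrix (Fin n) (Fin n) (H →WOT[ℂ] H) => ρ (ofWOT X)) {X | ‖ofWOT X‖ ≤ r}

/-- `x ∈ B(H ⊗ ℂⁿ)` has trace `c`: for every orthonormal basis `(e_k)` of `H`, the sum of the
diagonal coefficients of `x` in the orthonormal basis `(e_k ⊗ f_i)` of `H ⊗ ℂⁿ` converges
(unconditionally) to `c`, where `(f_i)` is the standard basis of `ℂⁿ`. -/
def HasTrace (x : BTensorMat H n) (c : ℂ) : Prop :=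
  ∀ (w : Set H) (e : HilbertBasis w ℂ H),
    HasSum (fun p : w × Fin n => ⟪e p.1, x p.2 p.2 (e p.1)⟫_ℂ) c

/-- `x` is of trace class: its absolute value `|x|`, the positive square root `p` of `x⋆ x`, has
finite trace. -/
def IsTraceClass (x : BTensorMat H n) : Prop :=
  ∃ p : BTensorMat H n, 0 ≤ p ∧ p * p = star x * x ∧ ∃ c : ℂ, HasTrace p c

/-- `h` is the density operator of `ρ`: it is a positive trace class operator and
`ρ(x) = Tr(h x)` for all `x`. -/
def IsDensityOperator (h : BTensorMat H n) (ρ : StrongDual ℂ (BTensorMat H n)) : Prop :=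
  0 ≤ h ∧ IsTraceClass h ∧ ∀ x : BTensorMat H n, HasTrace (h * x) (ρ x)

/-- The elementary tensor `a ⊗ b`. -/
def tmul (a : H →L[ℂ] H) (b : Mat n) : BTensorMat H n :=
  CStarMatrix.ofMatrix fun i j => b i j • a

/-- `η` is a product state `σ ⊗ ω`. (Every state `ω` of `M_n` is normal.) -/
def IsProductState (η : StrongDual ℂ (BTensorMat H n)) : Prop :=
  ∃ (σ : StrongDual ℂ (H →L[ℂ] H)) (ω : StrongDual ℂ (Mat n)), IsState σ ∧ IsState ω ∧
    ∀ (a : H →L[ℂ] H) (b : Mat n), η (tmul a b) = σ a * ω b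

/-- A functional is separable if it belongs to the norm closure of the positive sums (linear
combinations with nonnegative coefficients) of product states. -/
def IsSeparable (ρ : StrongDual ℂ (BTensorMat H n)) : Prop :=
  ρ ∈ closure (Submodule.span ℝ≥0 {η : StrongDual ℂ (BTensorMat H n) | IsProductState η} :
    Set (StrongDual ℂ (BTensorMat H n)))

/-- A functional is entangled if it is not separable. -/
def IsEntangled (ρ : StrongDual ℂ (BTensorMat H n)) : Prop :=
  ¬ IsSeparable ρ

/-- The partial transpose on `B(H) ⊗ M_n`: the transpose map of `M_n` on the factor `M_n`, the
identity on `B(H)`. -/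
def partialTransposeMat (x : BTensorMat H n) : BTensorMat H n :=
  x.transpose

/-- The Peres condition: `ρ ∘ (ι ⊗ t)` is positive on `B(H) ⊗ M_n`. -/
def PeresCondition (ρ : StrongDual ℂ (BTensorMat H n)) : Prop :=
  ∀ x : BTensorMat H n, 0 ≤ x → 0 ≤ ρ (partialTransposeMat x)

/-- The conjugation `∑ c_k e_k ↦ ∑ c̄_k e_k` of `H` in the orthonormal basis `e`. -/
def conjugation {κ : Type*} (e : HilbertBasis κ ℂ H) : H →L⋆[ℂ] H :=
  ((e.repr.trans (starₗᵢ ℂ)).trans e.repr.symm).toContinuousLinearEquiv.toContinuousLinearMap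

/-- The transpose map of `B(H)` with respect to the orthonormal basis `e`: `T ↦ J T⋆ J` with `J`
the conjugation in the basis `e`. -/
def transposeOp {κ : Type*} (e : HilbertBasis κ ℂ H) (T : H →L[ℂ] H) : H →L[ℂ] H :=
  ((conjugation e).comp (ContinuousLinearMap.adjoint T)).comp (conjugation e)

/-- The partial transpose on `B(H) ⊗ M_n` which is the transpose map of `B(H)`, with respect to the
orthonormal basis `e`, on the factor `B(H)` and the identity on `M_n`. -/
def partialTransposeOp {κ : Type*} (e : HilbertBasis κ ℂ H) (x : BTensorMat H n) :
    BTensorMat H n :=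
  x.map (transposeOp e)

/-- The map `B(H) ⊗ M_n → M_n ⊗ M_n` that is `φ` on the factor `B(H)` and the identity on the
factor `M_n`. -/
def ampliate (φ : (H →L[ℂ] H) → Mat n) (x : BTensorMat H n) :
    CStarMatrix (Fin n) (Fin n) (Mat n) :=
  x.map φ

end Hilbert

end SepStates

end

noncomputable section

namespace SepStates

/-! A map `φ : A → M_n` is encoded by the functional `pairing φ` on `A ⊗ M_n`, which is the vector
functional at `∑ e_i ⊗ e_i` composed with the ampliation of `φ`. By duality, if it were nonnegative
on every positive `x` with positive partial transpose, it would split as `f₁ + f₂ ∘ transpose` with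
`f₁`, `f₂` positive (`exists_positive_extension`); reading this back through `choiMap` would make
`φ` decomposable. So a nondecomposable `φ` has an `x ≥ 0` with positive partial transpose on which
`pairing φ` fails to be nonnegative.

Normality of `φ` allows `x` to be cut down to a finite-dimensional subspace of `H`
(`tendsto_pairing_compress`). The compressed `x`, divided by its trace, is the density operator `h`.
On the span of the chosen vectors `pairing φ` is given by an operator `witness b φ`, in the sense
that `Tr(h W) = pairing φ h`. Since `φ` is positive, this witness is nonnegative on product states,
hence on separable functionals; so `ρ = Tr(h ·)` is entangled. Since `pairing φ h` is a
quadratic-form value of `ampliate φ h`, that matrix is not positive either. -/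

theorem ofMatrix_entry {m k : Type*} {A : Type*} (M : m → k → A) (i : m) (j : k) :
    CStarMatrix.ofMatrix M i j = M i j := rfl

theorem sum_entry {m k ι : Type*} {A : Type*} [AddCommMonoid A] (s : Finset ι)
    (f : ι → CStarMatrix m k A) (i : m) (j : k) : (∑ p ∈ s, f p) i j = ∑ p ∈ s, f p i j :=
  Matrix.sum_apply i j s f

theorem exists_eq_star_mul_self {B : Type*} [CStarAlgebra B] [PartialOrder B] [StarOrderedRing B]
    {b : B} (hb : 0 ≤ b) : ∃ s, b = star s * s :=
  CStarAlgebra.nonneg_iff_eq_star_mul_self.mp hb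

/-! ### Positive matrices over a C⋆-algebra as Gram matrices. -/

section Matrices

/-- A complex matrix with nonnegative quadratic form is positive semidefinite. -/
theorem posSemidef_of_quadraticForm_nonneg {ι : Type*} [Fintype ι] [DecidableEq ι]
    {M : Matrix ι ι ℂ} (hM : ∀ ξ : ι → ℂ, 0 ≤ ∑ a, ∑ b, star (ξ a) * M a b * ξ b) :
    M.PosSemidef := by
  rw [← Matrix.isPositive_toEuclideanLin_iff, LinearMap.isPositive_iff_complex]
  intro v
  have h := hM v
  have e : ⟪Matrix.toEuclideanLin M v, v⟫_ℂ = star (∑ a, ∑ b, star (v a) * M a b * v b) := by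
    simp only [PiLp.inner_apply, Matrix.toLpLin_apply, Matrix.mulVec, dotProduct, map_sum, star_sum,
      RCLike.inner_apply, Finset.mul_sum, star_mul', star_star]
    refine Finset.sum_congr rfl fun a _ => Finset.sum_congr rfl fun b _ => ?_
    simp; ring
  rw [e, (IsSelfAdjoint.of_nonneg h).star_eq]
  exact ⟨Complex.conj_eq_iff_re.mp (IsSelfAdjoint.of_nonneg h).star_eq,
    (Complex.nonneg_iff.mp h).1⟩

variable {A : Type*} [CStarAlgebra A] [PartialOrder A] [StarOrderedRing A] {n : ℕ}

/-- Gram matrices over a C⋆-algebra are positive. -/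
theorem gram_nonneg {κ : Type*} [Fintype κ] (t : κ → Fin n → A) :
    0 ≤ (CStarMatrix.ofMatrix fun i j => ∑ p, star (t p i) * t p j :
      CStarMatrix (Fin n) (Fin n) A) := by
  have e : (CStarMatrix.ofMatrix fun i j => ∑ p, star (t p i) * t p j :
      CStarMatrix (Fin n) (Fin n) A) =
      ∑ p, CStarMatrix.ofMatrix fun i j => star (t p i) * t p j := by
    ext i j
    simp only [sum_entry, ofMatrix_entry]
  rw [e]
  refine Finset.sum_nonneg fun p _ => ?_
  -- The row `t p` is placed in row `0` of an otherwise zero square matrix `s`, giving the Gram term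
  -- as `star s * s`; this needs an index `0`.
  rcases n with _ | n
  · exact le_of_eq (CStarMatrix.ext fun i => i.elim0)
  · have e : (CStarMatrix.ofMatrix fun i j => star (t p i) * t p j :
        CStarMatrix (Fin (n + 1)) (Fin (n + 1)) A) =
        star (CStarMatrix.ofMatrix fun q j => if q = 0 then t p j else 0) *
          CStarMatrix.ofMatrix fun q j => if q = 0 then t p j else 0 := by
      ext i j
      simp [CStarMatrix.mul_apply, CStarMatrix.star_apply, ofMatrix_entry]
    rw [e]
    exact star_mul_self_nonneg _

/-- Converse of `gram_nonneg`. Together they reduce most positivity claims below to algebra with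
entries. -/
theorem exists_gram_of_nonneg {x : CStarMatrix (Fin n) (Fin n) A} (hx : 0 ≤ x) :
    ∃ t : Fin n → Fin n → A, ∀ i j, x i j = ∑ p, star (t p i) * t p j := by
  obtain ⟨s, rfl⟩ := exists_eq_star_mul_self hx
  exact ⟨fun p i => s p i, fun i j => by simp [CStarMatrix.mul_apply, CStarMatrix.star_apply]⟩

/-- Positivity in `M_k(M_n)` is detected by the quadratic form of `ℂᵏ ⊗ ℂⁿ`. -/
theorem nonneg_of_quadraticForm_nonneg {k : ℕ} {B : CStarMatrix (Fin k) (Fin k) (Mat n)}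
    (hB : ∀ ξ : Fin k × Fin n → ℂ,
      0 ≤ ∑ a, ∑ b, star (ξ a) * B a.1 b.1 a.2 b.2 * ξ b) : 0 ≤ B := by
  have h := posSemidef_of_quadraticForm_nonneg
    (M := Matrix.of fun a b : Fin k × Fin n => B a.1 b.1 a.2 b.2) hB
  obtain ⟨S, hS⟩ : ∃ S, Matrix.of (fun a b : Fin k × Fin n => B a.1 b.1 a.2 b.2) =
      star S * S := by
    open scoped MatrixOrder Matrix.Norms.L2Operator in
    exact CStarAlgebra.nonneg_iff_eq_star_mul_self.mp h.nonneg
  -- The rows of `S` are cut into `k` blocks of `n`; with a column block they form elements of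
  -- `M_n`, and `B` is their Gram matrix.
  have e : B = CStarMatrix.ofMatrix fun a b => ∑ p,
      star (CStarMatrix.ofMatrix fun q i => S (p, q) (a, i) : Mat n) *
        (CStarMatrix.ofMatrix fun q i => S (p, q) (b, i) : Mat n) := by
    ext a b i j
    have := congrFun (congrFun hS (a, i)) (b, j)
    simp only [Matrix.of_apply] at this
    rw [this, Matrix.mul_apply, Fintype.sum_prod_type]
    simp only [ofMatrix_entry, sum_entry, CStarMatrix.mul_apply, CStarMatrix.star_apply]
    rfl
  rw [e]
  exact gram_nonneg _

end Matrices

/-! ### The correspondence between maps `A → M_n` and functionals on `A ⊗ M_n`. -/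

section Choi

variable {A : Type*} [CStarAlgebra A] {n : ℕ}

/-- The functional `∑ x_{ij} ⊗ e_{ij} ↦ ∑ φ(x_{ij})_{ij}` on `A ⊗ M_n` defined by `φ : A → M_n`. -/
def pairing (φ : A →ₗ[ℂ] Mat n) : CStarMatrix (Fin n) (Fin n) A →ₗ[ℂ] ℂ where
  toFun x := ∑ i, ∑ j, φ (x i j) i j
  map_add' x y := by simp [Finset.sum_add_distrib]
  map_smul' c x := by simp [Finset.mul_sum]

theorem pairing_apply (φ : A →ₗ[ℂ] Mat n) (x : CStarMatrix (Fin n) (Fin n) A) :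
    pairing φ x = ∑ i, ∑ j, φ (x i j) i j := rfl

/-- The linear map `a ↦ (f(a ⊗ e_{ij}))` defined by a functional `f` on `A ⊗ M_n`. -/
def choiMap (f : CStarMatrix (Fin n) (Fin n) A →ₗ[ℂ] ℂ) : A →ₗ[ℂ] Mat n where
  toFun a := CStarMatrix.ofMatrix fun i j => f (CStarMatrix.ofMatrix (Matrix.single i j a))
  map_add' a b := by
    ext i j
    simp [Matrix.single_add, ← CStarMatrix.of_add_of, ofMatrix_entry]
  map_smul' c a := by
    ext i j
    simp [← Matrix.smul_single, ← CStarMatrix.smul_of, ofMatrix_entry]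

theorem choiMap_apply (f : CStarMatrix (Fin n) (Fin n) A →ₗ[ℂ] ℂ) (a : A) (i j : Fin n) :
    choiMap f a i j = f (CStarMatrix.ofMatrix (Matrix.single i j a)) := rfl

theorem choiMap_pairing (φ : A →ₗ[ℂ] Mat n) : choiMap (pairing φ) = φ := by
  ext a i j
  rw [choiMap_apply, pairing_apply, Finset.sum_eq_single i, Finset.sum_eq_single j]
  · simp
  · intro l _ hl
    simp [hl.symm]
  · simp
  · intro l _ hl
    simp [hl.symm]
  · simp

theorem sum_apply_single (f : CStarMatrix (Fin n) (Fin n) A →ₗ[ℂ] ℂ)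
    (x : CStarMatrix (Fin n) (Fin n) A) :
    ∑ i, ∑ j, f (CStarMatrix.ofMatrix (Matrix.single i j (x i j))) = f x := by
  have : x = ∑ i, ∑ j, CStarMatrix.ofMatrix (Matrix.single i j (x i j)) :=
    Matrix.matrix_eq_sum_single (x : Matrix (Fin n) (Fin n) A)
  conv_rhs => rw [this]
  simp [map_sum]

/-- The partial transpose of `A ⊗ M_n` as a linear map. -/
def transposeₗ : CStarMatrix (Fin n) (Fin n) A →ₗ[ℂ] CStarMatrix (Fin n) (Fin n) A where
  toFun x := x.transpose
  map_add' _ _ := rfl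
  map_smul' _ _ := rfl

/-- Partial transposition on the side of functionals becomes `t ∘ ·` on the side of maps; this is
what makes the second summand of the decomposition copositive. -/
theorem transposeMat_comp_choiMap (f : CStarMatrix (Fin n) (Fin n) A →ₗ[ℂ] ℂ) :
    transposeMat n ∘ₗ choiMap (f ∘ₗ transposeₗ) = choiMap f := by
  ext a i j
  change f (Matrix.transpose (Matrix.single j i a)) = f (Matrix.single i j a)
  rw [Matrix.transpose_single]

variable [PartialOrder A] [StarOrderedRing A]

/-- A positive functional on `A ⊗ M_n` defines a completely positive map `A → M_n`. -/
theorem isCompletelyPositive_choiMap {f : CStarMatrix (Fin n) (Fin n) A →ₗ[ℂ] ℂ}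
    (hf : ∀ x, 0 ≤ x → 0 ≤ f x) : IsCompletelyPositive (choiMap f) := by
  refine ⟨⟨choiMap f, fun k M hM => nonneg_of_quadraticForm_nonneg fun ξ => ?_⟩, rfl⟩
  obtain ⟨t, ht⟩ := exists_gram_of_nonneg hM
  -- With `M a b = ∑ p, star (t p a) * t p b`, the quadratic form at `ξ` is `f` evaluated at the
  -- Gram matrix of the combinations `∑ l, ξ (l, i) • t p l`.
  refine (hf _ (gram_nonneg fun p i => ∑ l, ξ (l, i) • t p l)).trans_eq ?_
  have e (i j : Fin n) : f (CStarMatrix.ofMatrix (Matrix.single i j (∑ p,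
      star (∑ l, ξ (l, i) • t p l) * ∑ l, ξ (l, j) • t p l))) =
      ∑ a, ∑ b, star (ξ (a, i)) * choiMap f (M a b) i j * ξ (b, j) := by
    change choiMap f _ i j = _
    have : ∑ p, star (∑ l, ξ (l, i) • t p l) * ∑ l, ξ (l, j) • t p l =
        ∑ a, ∑ b, (star (ξ (a, i)) * ξ (b, j)) • M a b := by
      simp only [ht, star_sum, star_smul, Finset.sum_mul_sum, Finset.smul_sum, smul_mul_smul_comm]
      rw [Finset.sum_comm]
      exact Finset.sum_congr rfl fun _ _ => Finset.sum_comm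
    simp only [this, map_sum, map_smul, sum_entry, CStarMatrix.smul_apply, smul_eq_mul]
    exact Finset.sum_congr rfl fun _ _ => Finset.sum_congr rfl fun _ _ => by ring
  rw [← sum_apply_single]
  simp only [ofMatrix_entry, e, CStarMatrix.map_apply, Fintype.sum_prod_type]
  rw [Finset.sum_congr rfl fun i _ => Finset.sum_comm, Finset.sum_comm]
  refine Finset.sum_congr rfl fun a _ => Finset.sum_congr rfl fun i _ => ?_
  rw [Finset.sum_comm]

/-- The functional on `A ⊗ M_n` defined by a positive map is Hermitian. -/
theorem pairing_star (φ : A →ₚ[ℂ] Mat n) (x : CStarMatrix (Fin n) (Fin n) A) :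
    pairing φ.toLinearMap (star x) = star (pairing φ.toLinearMap x) := by
  simp only [pairing_apply, star_sum]
  rw [Finset.sum_comm]
  refine Finset.sum_congr rfl fun i _ => Finset.sum_congr rfl fun j _ => ?_
  have : φ (star (x i j)) = star (φ (x i j)) := map_star φ _
  simp only [CStarMatrix.star_apply]
  exact congrFun (congrFun this j) i

end Choi

/-! ### Extension of positive functionals and the duality argument. -/

section Riesz

variable {B : Type*} [CStarAlgebra B] [PartialOrder B] [StarOrderedRing B]

/-- The real cone of the elements with positive real part. -/
def accretiveCone (B : Type*) [CStarAlgebra B] [PartialOrder B] [StarOrderedRing B] :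
    PointedCone ℝ B where
  carrier := {x | 0 ≤ x + star x}
  add_mem' {x y} hx hy := by
    have h : x + y + star (x + y) = x + star x + (y + star y) := by rw [star_add]; abel
    simpa only [Set.mem_ofPred_eq, h] using add_nonneg hx hy
  zero_mem' := by simp
  smul_mem' c x hx := by
    change 0 ≤ (c : ℝ) • x + star ((c : ℝ) • x)
    rw [star_smul, star_trivial, ← smul_add]
    exact smul_nonneg c.2 hx

theorem mem_accretiveCone {x : B} : x ∈ accretiveCone B ↔ 0 ≤ x + star x := Iff.rfl

/-- The unit is an order unit. This supplies the cofinality hypothesis of `riesz_extension`; a whole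
ray of constants is kept so that two elements can share one. -/
theorem exists_smul_one_add_mem_accretiveCone (x : B) :
    ∃ r : ℝ, ∀ s : ℝ, r ≤ s → s • (1 : B) + x ∈ accretiveCone B := by
  refine ⟨‖x + star x‖, fun s hs => ?_⟩
  have h1 := (IsSelfAdjoint.add_star_self x).neg_algebraMap_norm_le_self
  rw [Algebra.algebraMap_eq_smul_one] at h1
  have h0 : (0 : ℝ) ≤ s := (norm_nonneg _).trans hs
  have h2 : (0 : B) ≤ s • (1 : B) := smul_nonneg h0 zero_le_one
  have h3 : ‖x + star x‖ • (1 : B) ≤ s • (1 : B) := smul_le_smul_of_nonneg_right hs zero_le_one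
  rw [mem_accretiveCone]
  have e : s • (1 : B) + x + star (s • (1 : B) + x) = s • (1 : B) + (s • (1 : B) + (x + star x)) := by
    simp only [star_add, star_smul, star_one, star_trivial]; abel
  rw [e]
  refine add_nonneg h2 ?_
  have h4 := neg_le_iff_add_nonneg'.mp h1
  exact h4.trans (add_le_add_left h3 _)

/-- Let `Γ` be a Hermitian unital linear map of a C⋆-algebra. A Hermitian functional which is
nonnegative on the elements `x ≥ 0` with `Γ x ≥ 0` is of the form `f₁ + f₂ ∘ Γ` with positive
functionals `f₁` and `f₂`. -/
theorem exists_positive_extension (Γ : B →ₗ[ℂ] B) (hΓ : Γ 1 = 1)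
    (hΓs : ∀ x, Γ (star x) = star (Γ x)) (F : B →ₗ[ℂ] ℂ) (hFs : ∀ x, F (star x) = star (F x))
    (hF : ∀ x, 0 ≤ x → 0 ≤ Γ x → 0 ≤ F x) :
    ∃ f₁ f₂ : B →ₗ[ℂ] ℂ, (∀ x, 0 ≤ x → 0 ≤ f₁ x) ∧ (∀ x, 0 ≤ x → 0 ≤ f₂ x) ∧
      F = f₁ + f₂ ∘ₗ Γ := by
  -- `Re F` is regarded as a functional on the graph of `Γ` in `B × B`. A positive extension to `B ×
  -- B` is a sum of functionals of the two coordinates, which produces `f₁` and `f₂`.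
  let F₀ : (B × B) →ₗ.[ℝ] ℝ :=
    { domain := LinearMap.graph (Γ.restrictScalars ℝ)
      toFun := (Complex.reLm ∘ₗ F.restrictScalars ℝ) ∘ₗ LinearMap.fst ℝ B B ∘ₗ
        (LinearMap.graph (Γ.restrictScalars ℝ)).subtype }
  obtain ⟨g, hg, hgs⟩ := riesz_extension ((accretiveCone B).prod (accretiveCone B)) F₀ (by
      rintro ⟨⟨x, y⟩, hxy⟩ ⟨hx, hy⟩
      obtain rfl : y = Γ x := hxy
      change 0 ≤ (F x).re
      have h := (Complex.nonneg_iff.mp (hF (x + star x) hx (by rw [map_add, hΓs]; exact hy))).1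
      rw [map_add, hFs, Complex.add_re, Complex.star_def, Complex.conj_re] at h
      linarith) (by
      rintro ⟨x, y⟩
      obtain ⟨r, hr⟩ := exists_smul_one_add_mem_accretiveCone x
      obtain ⟨s, hs⟩ := exists_smul_one_add_mem_accretiveCone y
      refine ⟨⟨(max r s • 1, max r s • 1), ?_⟩, hr _ (le_max_left _ _), hs _ (le_max_right _ _)⟩
      change max r s • (1 : B) = Γ.restrictScalars ℝ (max r s • (1 : B))
      rw [map_smul]; simp [hΓ])
  have skew (x : B) (hx : 0 ≤ x) : (Complex.I • x) + star (Complex.I • x) = 0 := by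
    rw [star_smul, (IsSelfAdjoint.of_nonneg hx).star_eq, ← add_smul]; simp
  -- A pair of skew-adjoint elements lies in the cone together with its negative, so `g` vanishes on
  -- it.
  have key (p : B × B) (h1 : p.1 + star p.1 = 0) (h2 : p.2 + star p.2 = 0) : g p = 0 := by
    refine le_antisymm ?_ (hgs p ⟨h1.ge, h2.ge⟩)
    have := hgs (-p) ⟨?_, ?_⟩
    · simpa using this
    · simp only [Prod.fst_neg, SetLike.mem_coe, mem_accretiveCone, star_neg, ← neg_add, h1, neg_zero, le_refl]
    · simp only [Prod.snd_neg, SetLike.mem_coe, mem_accretiveCone, star_neg, ← neg_add, h2, neg_zero, le_refl]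
  have nn (x : B) (hx : 0 ≤ x) : x ∈ accretiveCone B := by
    rw [mem_accretiveCone, (IsSelfAdjoint.of_nonneg hx).star_eq]; exact add_nonneg hx hx
  -- The complex functionals with real parts `g (·, 0)` and `g (0, ·)`. Their imaginary part at `x ≥
  -- 0` is given by `g` at the skew element `I • x`, hence is zero.
  refine ⟨Module.Dual.extendRCLike (𝕜 := ℂ) (g ∘ₗ LinearMap.inl ℝ B B),
    Module.Dual.extendRCLike (𝕜 := ℂ) (g ∘ₗ LinearMap.inr ℝ B B), fun x hx => ?_, fun x hx => ?_, ?_⟩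
  · have h : g (Complex.I • x, 0) = 0 := key _ (skew x hx) (by simp)
    have h' : 0 ≤ g (x, 0) := hgs _ ⟨nn x hx, zero_mem _⟩
    simpa [Module.Dual.extendRCLike_apply, h] using h'
  · have h : g (0, Complex.I • x) = 0 := key _ (by simp) (skew x hx)
    have h' : 0 ≤ g (0, x) := hgs _ ⟨zero_mem _, nn x hx⟩
    simpa [Module.Dual.extendRCLike_apply, h] using h'
  · ext x
    have h (x : B) : g (x, 0) + g (0, Γ x) = (F x).re := by
      rw [← map_add, Prod.mk_add_mk, add_zero, zero_add]
      exact hg ⟨(x, Γ x), rfl⟩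
    have h1 := h x
    have h2 := h (Complex.I • x)
    simp only [map_smul, smul_eq_mul, Complex.mul_re, Complex.I_re, Complex.I_im] at h2
    apply Complex.ext <;>
    simp [Module.Dual.extendRCLike_apply] <;> linarith

end Riesz

/-! ### The decomposability criterion. -/

section Decomposable

variable {A : Type*} [CStarAlgebra A] [PartialOrder A] [StarOrderedRing A] {n : ℕ}

/-- A positive map `A → M_n` is decomposable if its functional on `A ⊗ M_n` is nonnegative on the
positive elements with positive partial transpose. -/
theorem isDecomposable_of_pairing_nonneg (φ : A →ₚ[ℂ] Mat n)
    (h : ∀ x : CStarMatrix (Fin n) (Fin n) A, 0 ≤ x → 0 ≤ x.transpose →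
      0 ≤ pairing φ.toLinearMap x) : IsDecomposable φ.toLinearMap := by
  obtain ⟨f₁, f₂, h₁, h₂, h⟩ := exists_positive_extension
    (B := CStarMatrix (Fin n) (Fin n) A) transposeₗ (Matrix.transpose_one)
    (fun x => rfl) (pairing φ.toLinearMap) (pairing_star φ) h
  refine ⟨choiMap f₁, choiMap (f₂ ∘ₗ transposeₗ), isCompletelyPositive_choiMap h₁, ?_, ?_⟩
  · rw [IsCopositive, transposeMat_comp_choiMap]
    exact isCompletelyPositive_choiMap h₂
  · rw [← choiMap_pairing φ.toLinearMap, h]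
    rfl

end Decomposable

/-! ### Compression to a finite-dimensional subspace and trace functionals. -/

section Compression

open InnerProductSpace

variable {H : Type*} [NormedAddCommGroup H] [InnerProductSpace ℂ H] {n : ℕ}
  {κ : Type*} [Fintype κ] {b : κ → H}

/-- The operator `∑ |b_k⟩⟨b_k|`, the orthogonal projection onto the span of an orthonormal
family `b`. -/
def spanProj (b : κ → H) : H →L[ℂ] H := ∑ k, rankOne ℂ (b k) (b k)

theorem spanProj_apply (b : κ → H) (v : H) : spanProj b v = ∑ k, ⟪b k, v⟫_ℂ • b k := by
  simp [spanProj]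

theorem spanProj_apply_self (hb : Orthonormal ℂ b) (k : κ) : spanProj b (b k) = b k := by
  classical
  rw [spanProj_apply, Finset.sum_eq_single k]
  · simp [hb.1 k]
  · intro l _ hl
    simp [hb.2 hl]
  · simp

theorem spanProj_mul_self (hb : Orthonormal ℂ b) : spanProj b * spanProj b = spanProj b := by
  ext v
  simp only [mul_apply_eq_comp, spanProj_apply b v, map_sum, map_smul,
    spanProj_apply_self hb]

variable [CompleteSpace H]

theorem star_spanProj (b : κ → H) : star (spanProj b) = spanProj b := by
  simp [spanProj, star_sum, ContinuousLinearMap.star_eq_adjoint]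

theorem inner_spanProj_left (b : κ → H) (u v : H) : ⟪spanProj b u, v⟫_ℂ = ⟪u, spanProj b v⟫_ℂ := by
  conv_rhs => rw [← star_spanProj b, ContinuousLinearMap.star_eq_adjoint,
    ContinuousLinearMap.adjoint_inner_right]

theorem norm_spanProj_le (hb : Orthonormal ℂ b) : ‖spanProj b‖ ≤ 1 := by
  have h := CStarRing.norm_star_mul_self (x := spanProj b)
  rw [star_spanProj, spanProj_mul_self hb] at h
  nlinarith [norm_nonneg (spanProj b)]

/-- The compression of an operator matrix to the span of `b`. -/
def compress (b : κ → H) (x : BTensorMat H n) : BTensorMat H n :=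
  CStarMatrix.ofMatrix fun i j => spanProj b * x i j * spanProj b

theorem compress_entry (b : κ → H) (x : BTensorMat H n) (i j : Fin n) :
    compress b x i j = spanProj b * x i j * spanProj b := rfl

theorem compress_nonneg (b : κ → H) {x : BTensorMat H n} (hx : 0 ≤ x) : 0 ≤ compress b x := by
  obtain ⟨t, ht⟩ := exists_gram_of_nonneg hx
  convert gram_nonneg fun p i => t p i * spanProj b using 1
  ext1 i j
  simp only [compress_entry, ht, ofMatrix_entry, Finset.mul_sum, Finset.sum_mul, star_mul,
    star_spanProj, mul_assoc]

/-- `h` is supported on the span of `b`. -/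
def IsSupportedOn (b : κ → H) (h : BTensorMat H n) : Prop :=
  ∀ i j, spanProj b * h i j * spanProj b = h i j

theorem isSupportedOn_compress (hb : Orthonormal ℂ b) (x : BTensorMat H n) :
    IsSupportedOn b (compress b x) := fun i j => by
  simp only [compress_entry, mul_assoc, spanProj_mul_self hb]
  simp only [← mul_assoc, spanProj_mul_self hb]

theorem IsSupportedOn.smul {h : BTensorMat H n} (hh : IsSupportedOn b h) (c : ℝ) :
    IsSupportedOn b (c • h) := fun i j => by
  simp only [CStarMatrix.smul_apply, mul_smul_comm, smul_mul_assoc, hh i j]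

theorem IsSupportedOn.transpose {h : BTensorMat H n} (hh : IsSupportedOn b h) :
    IsSupportedOn b (partialTransposeMat h) := fun i j => hh j i

theorem IsSupportedOn.spanProj_mul (hb : Orthonormal ℂ b) {h : BTensorMat H n}
    (hh : IsSupportedOn b h) (i j : Fin n) : spanProj b * h i j = h i j := by
  rw [← hh i j, ← mul_assoc, ← mul_assoc, spanProj_mul_self hb]

theorem IsSupportedOn.mul_spanProj (hb : Orthonormal ℂ b) {h : BTensorMat H n}
    (hh : IsSupportedOn b h) (i j : Fin n) : h i j * spanProj b = h i j := by
  rw [← hh i j, mul_assoc, spanProj_mul_self hb]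

theorem IsSupportedOn.eq_sum_rankOne {h : BTensorMat H n} (hh : IsSupportedOn b h) (i j : Fin n) :
    h i j = ∑ r, ∑ s, ⟪b r, h i j (b s)⟫_ℂ • rankOne ℂ (b r) (b s) := by
  conv_lhs => rw [← hh i j]
  ext v
  simp only [mul_apply_eq_comp, spanProj_apply, map_sum, map_smul,
    sum_apply, smul_apply, rankOne_apply, smul_smul]
  rw [Finset.sum_comm]
  refine Finset.sum_congr rfl fun s _ => ?_
  rw [Finset.smul_sum]
  refine Finset.sum_congr rfl fun r _ => ?_
  rw [smul_smul, mul_comm]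

/-- The scalar matrix of the compression of `x` to the span of `b`. -/
def opMatrix (b : κ → H) (x : BTensorMat H n) : Matrix (Fin n × κ) (Fin n × κ) ℂ :=
  Matrix.of fun a c => ⟪b a.2, x a.1 c.1 (b c.2)⟫_ℂ

theorem opMatrix_posSemidef (b : κ → H) {x : BTensorMat H n} (hx : 0 ≤ x) :
    (opMatrix b x).PosSemidef := by
  classical
  refine posSemidef_of_quadraticForm_nonneg fun ξ => ?_
  obtain ⟨t, ht⟩ := exists_gram_of_nonneg hx
  -- The quadratic form is a sum of squared norms of vectors of `H`, one for each row of the Gram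
  -- factor `t`.
  have e : ∑ a, ∑ c, star (ξ a) * opMatrix b x a c * ξ c =
      ∑ p, ⟪∑ a, ξ a • t p a.1 (b a.2), ∑ a, ξ a • t p a.1 (b a.2)⟫_ℂ := by
    simp only [opMatrix, Matrix.of_apply, ht, sum_apply, inner_sum,
      Finset.mul_sum, Finset.sum_mul, mul_apply_eq_comp,
      ContinuousLinearMap.star_eq_adjoint, ContinuousLinearMap.adjoint_inner_right, sum_inner,
      inner_smul_left, inner_smul_right]
    rw [Finset.sum_congr rfl fun _ _ => Finset.sum_comm, Finset.sum_comm]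
    refine Finset.sum_congr rfl fun p _ => ?_
    rw [Finset.sum_comm]
    refine Finset.sum_congr rfl fun a _ => Finset.sum_congr rfl fun c _ => ?_
    simp only [RCLike.star_def]
    ring
  rw [e]
  exact Finset.sum_nonneg fun p _ => by
    rw [inner_self_eq_norm_sq_to_K]
    positivity

theorem trace_mul_nonneg_of_posSemidef {ι : Type*} [Fintype ι] [DecidableEq ι] {M N : Matrix ι ι ℂ}
    (hM : M.PosSemidef) (hN : N.PosSemidef) : 0 ≤ (M * N).trace := by
  obtain ⟨S, rfl⟩ : ∃ S, M = star S * S := by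
    open scoped MatrixOrder Matrix.Norms.L2Operator in
    exact CStarAlgebra.nonneg_iff_eq_star_mul_self.mp hM.nonneg
  rw [mul_assoc, Matrix.trace_mul_comm]
  exact (hN.mul_mul_conjTranspose_same S).trace_nonneg

/-- The functional `x ↦ Tr(h x)` for `h` supported on the span of `b`. -/
def traceFunctional (b : κ → H) (h : BTensorMat H n) : StrongDual ℂ (BTensorMat H n) where
  toFun x := ∑ i, ∑ j, ∑ r, ⟪b r, h i j (x j i (b r))⟫_ℂ
  map_add' x y := by simp [Finset.sum_add_distrib]
  map_smul' c x := by simp [Finset.mul_sum]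
  cont := by
    have h (i j : Fin n) : Continuous fun x : BTensorMat H n => x i j :=
      continuous_apply_apply (ρ := fun _ _ => H →L[ℂ] H) i j
    fun_prop

theorem traceFunctional_apply (b : κ → H) (h x : BTensorMat H n) :
    traceFunctional b h x = ∑ i, ∑ j, ∑ r, ⟪b r, h i j (x j i (b r))⟫_ℂ := rfl

theorem traceFunctional_smul (b : κ → H) (c : ℝ) (h x : BTensorMat H n) :
    traceFunctional b (c • h) x = c * traceFunctional b h x := by
  simp [traceFunctional_apply, Finset.mul_sum, inner_smul_right_eq_smul]

theorem traceFunctional_partialTranspose (b : κ → H) (h x : BTensorMat H n) :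
    traceFunctional b h (partialTransposeMat x) = traceFunctional b (partialTransposeMat h) x := by
  rw [traceFunctional_apply, traceFunctional_apply, Finset.sum_comm]
  rfl

/-- Turns positivity and faithfulness of the trace into statements about finite scalar matrices. -/
theorem traceFunctional_eq_trace (hb : Orthonormal ℂ b) {h : BTensorMat H n}
    (hh : IsSupportedOn b h) (x : BTensorMat H n) :
    traceFunctional b h x = (opMatrix b h * opMatrix b x).trace := by
  have e (i j : Fin n) (v : H) : h i j v = ∑ s, ⟪b s, v⟫_ℂ • h i j (b s) := by
    conv_lhs => rw [← hh.mul_spanProj hb, mul_apply_eq_comp, spanProj_apply]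
    simp
  simp only [traceFunctional_apply, Matrix.trace, Matrix.diag, Matrix.mul_apply,
    Fintype.sum_prod_type, opMatrix, Matrix.of_apply]
  refine Finset.sum_congr rfl fun i _ => ?_
  rw [Finset.sum_comm]
  refine Finset.sum_congr rfl fun r _ => Finset.sum_congr rfl fun j _ => ?_
  rw [e]
  simp [mul_comm]

theorem traceFunctional_nonneg (hb : Orthonormal ℂ b) {h x : BTensorMat H n}
    (hh : IsSupportedOn b h) (h0 : 0 ≤ h) (hx : 0 ≤ x) : 0 ≤ traceFunctional b h x := by
  classical
  rw [traceFunctional_eq_trace hb hh]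
  exact trace_mul_nonneg_of_posSemidef (opMatrix_posSemidef b h0) (opMatrix_posSemidef b hx)

theorem traceFunctional_one (b : κ → H) (h : BTensorMat H n) :
    traceFunctional b h 1 = (opMatrix b h).trace := by
  simp only [traceFunctional_apply, Matrix.trace, Matrix.diag, Fintype.sum_prod_type, opMatrix,
    Matrix.of_apply]
  refine Finset.sum_congr rfl fun i _ => ?_
  rw [Finset.sum_eq_single i]
  · simp
  · intro j _ hj
    simp [CStarMatrix.one_apply_ne hj]
  · simp

theorem eq_zero_of_traceFunctional_one_eq_zero {h : BTensorMat H n}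
    (hh : IsSupportedOn b h) (h0 : 0 ≤ h) (ht : traceFunctional b h 1 = 0) : h = 0 := by
  classical
  rw [traceFunctional_one, (opMatrix_posSemidef b h0).trace_eq_zero_iff] at ht
  ext1 i j
  rw [hh.eq_sum_rankOne i j]
  refine Finset.sum_eq_zero fun r _ => Finset.sum_eq_zero fun s _ => ?_
  have : ⟪b r, h i j (b s)⟫_ℂ = 0 := congrFun (congrFun ht (i, r)) (j, s)
  rw [this, zero_smul]

/-- Basis independence of the trace when the range of `T` lies in the span of `b`: expand in `b` and
apply Parseval's identity to each of the finitely many terms. -/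
theorem hasSum_inner_of_spanProj_mul {T : H →L[ℂ] H} (hT : spanProj b * T = T) {w : Type*}
    (e : HilbertBasis w ℂ H) :
    HasSum (fun k => ⟪e k, T (e k)⟫_ℂ) (∑ r, ⟪b r, T (b r)⟫_ℂ) := by
  have h : HasSum (fun k => ∑ r, ⟪star T (b r), e k⟫_ℂ * ⟪e k, b r⟫_ℂ)
      (∑ r, ⟪star T (b r), b r⟫_ℂ) :=
    hasSum_sum fun r _ => e.hasSum_inner_mul_inner _ _
  simp only [ContinuousLinearMap.star_eq_adjoint, ContinuousLinearMap.adjoint_inner_left] at h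
  convert h using 2 with k
  conv_lhs => rw [← hT, mul_apply_eq_comp, spanProj_apply]
  simp

theorem hasTrace_mul (hb : Orthonormal ℂ b) {h : BTensorMat H n} (hh : IsSupportedOn b h)
    (x : BTensorMat H n) : HasTrace (h * x) (traceFunctional b h x) := by
  intro w e
  have hs (i : Fin n) : HasSum (fun k => ⟪e k, (h * x) i i (e k)⟫_ℂ)
      (∑ r, ⟪b r, (h * x) i i (b r)⟫_ℂ) := by
    refine hasSum_inner_of_spanProj_mul ?_ e
    simp only [CStarMatrix.mul_apply, Finset.mul_sum, ← mul_assoc, hh.spanProj_mul hb]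
  -- The sum over `w × Fin n` is a finite sum of slices `w × {i}`, each extended by zero.
  have hf (i : Fin n) : HasSum (fun p : w × Fin n =>
      if p.2 = i then ⟪e p.1, (h * x) i i (e p.1)⟫_ℂ else 0)
      (∑ r, ⟪b r, (h * x) i i (b r)⟫_ℂ) := by
    rw [← Function.Injective.hasSum_iff (Prod.mk_left_injective i)]
    · simpa [Function.comp_def] using hs i
    · rintro ⟨k, j⟩ hk
      refine if_neg fun hj => hk ⟨k, ?_⟩
      simpa using hj.symm
  convert hasSum_sum fun i (_ : i ∈ Finset.univ) => hf i using 1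
  · ext p
    simp
  · simp only [traceFunctional_apply, CStarMatrix.mul_apply, sum_apply,
      mul_apply_eq_comp, inner_sum]
    exact Finset.sum_congr rfl fun i _ => Finset.sum_comm

theorem isNormalFunctional_traceFunctional (b : κ → H) (h : BTensorMat H n) :
    IsNormalFunctional (traceFunctional b h) := by
  intro r
  -- A finite sum of matrix coefficients is weakly continuous everywhere, not only on bounded sets.
  refine Continuous.continuousOn ?_
  change Continuous fun X : Matrix (Fin n) (Fin n) (H →WOT[ℂ] H) =>
    ∑ i, ∑ j, ∑ r, ⟪b r, h i j (X j i (b r))⟫_ℂ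
  refine continuous_finsetSum _ fun i _ => continuous_finsetSum _ fun j _ =>
    continuous_finsetSum _ fun r _ => ?_
  simp only [← ContinuousLinearMap.adjoint_inner_left]
  have h : Continuous fun X : Matrix (Fin n) (Fin n) (H →WOT[ℂ] H) => X j i :=
    continuous_apply_apply (ρ := fun _ _ => H →WOT[ℂ] H) j i
  exact ContinuousLinearMapWOT.continuous_iff.mp h _ _

end Compression

/-! ### Transposition on the factor `B(H)`. -/

section Transpose

variable {H : Type*} [NormedAddCommGroup H] [InnerProductSpace ℂ H] {n : ℕ}
  {κ : Type*}

theorem conjugation_conjugation (e : HilbertBasis κ ℂ H) (v : H) :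
    conjugation e (conjugation e v) = v := by
  simp [conjugation]

theorem inner_conjugation_conjugation (e : HilbertBasis κ ℂ H) (u v : H) :
    ⟪conjugation e u, conjugation e v⟫_ℂ = ⟪v, u⟫_ℂ := by
  rw [← e.hasSum_inner_mul_inner v u |>.tsum_eq, ← e.hasSum_inner_mul_inner _ _ |>.tsum_eq]
  have h (x : H) (k : κ) : ⟪e k, conjugation e x⟫_ℂ = ⟪x, e k⟫_ℂ := by
    rw [← e.repr_apply_apply, ← inner_conj_symm x, ← e.repr_apply_apply]
    simp [conjugation]
  refine tsum_congr fun k => ?_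
  rw [h, ← inner_conj_symm, h, inner_conj_symm, mul_comm]

theorem inner_conjugation_left (e : HilbertBasis κ ℂ H) (u v : H) :
    ⟪conjugation e u, v⟫_ℂ = ⟪conjugation e v, u⟫_ℂ := by
  rw [← conjugation_conjugation e v, inner_conjugation_conjugation, conjugation_conjugation]

variable [CompleteSpace H]

theorem transposeOp_apply (e : HilbertBasis κ ℂ H) (T : H →L[ℂ] H) (v : H) :
    transposeOp e T v = conjugation e (star T (conjugation e v)) := rfl

theorem transposeOp_mul (e : HilbertBasis κ ℂ H) (S T : H →L[ℂ] H) :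
    transposeOp e (S * T) = transposeOp e T * transposeOp e S := by
  ext v
  simp only [transposeOp_apply, mul_apply_eq_comp, conjugation_conjugation, star_mul]

theorem transposeOp_sum (e : HilbertBasis κ ℂ H) {ι : Type*} (s : Finset ι) (T : ι → H →L[ℂ] H) :
    transposeOp e (∑ i ∈ s, T i) = ∑ i ∈ s, transposeOp e (T i) := by
  ext v
  simp only [transposeOp_apply, star_sum, sum_apply, map_sum]

theorem transposeOp_star (e : HilbertBasis κ ℂ H) (T : H →L[ℂ] H) :
    transposeOp e (star T) = star (transposeOp e T) := by
  refine ContinuousLinearMap.ext fun v => ext_inner_left ℂ fun u => ?_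
  rw [ContinuousLinearMap.star_eq_adjoint (transposeOp e T),
    ContinuousLinearMap.adjoint_inner_right, transposeOp_apply, transposeOp_apply, star_star,
    inner_conjugation_left, ContinuousLinearMap.star_eq_adjoint,
    ContinuousLinearMap.adjoint_inner_right, ← inner_conj_symm, inner_conjugation_left,
    inner_conj_symm]

/-- The two partial transposes differ by the full transpose, which preserves positivity. Concretely,
the antimultiplicative `transposeOp e` turns the Gram form of `(h_{ji})` into a Gram form of the
transposed entries. -/
theorem partialTransposeOp_nonneg (e : HilbertBasis κ ℂ H) {h : BTensorMat H n}
    (hh : 0 ≤ partialTransposeMat h) : 0 ≤ partialTransposeOp e h := by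
  obtain ⟨t, ht⟩ := exists_gram_of_nonneg hh
  convert gram_nonneg fun p i => star (transposeOp e (t p i)) using 1
  ext1 i j
  have : h i j = ∑ p, star (t p j) * t p i := ht j i
  simp only [partialTransposeOp, CStarMatrix.map_apply, this, transposeOp_sum, transposeOp_mul,
    transposeOp_star, ofMatrix_entry, star_star]

end Transpose

/-! ### The entanglement witness. -/

section Witness

open InnerProductSpace

variable {H : Type*} [NormedAddCommGroup H] [InnerProductSpace ℂ H] [CompleteSpace H] {n : ℕ}
  {κ : Type*} [Fintype κ] {b : κ → H}

theorem transpose_nonneg {m : Mat n} (hm : 0 ≤ m) : 0 ≤ m.transpose := by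
  obtain ⟨t, ht⟩ := exists_gram_of_nonneg hm
  convert gram_nonneg fun p i => star (t p i) using 1
  ext1 i j
  simp only [CStarMatrix.transpose_apply, ht, ofMatrix_entry, star_star]
  exact Finset.sum_congr rfl fun _ _ => mul_comm _ _

/-- `pairing φ h` is the quadratic form of `ampliate φ h` at the vector `∑ e_i ⊗ e_i`. -/
theorem pairing_nonneg {φ : (H →L[ℂ] H) →ₗ[ℂ] Mat n} {h : BTensorMat H n}
    (hh : 0 ≤ ampliate φ h) : 0 ≤ pairing φ h := by
  obtain ⟨t, ht⟩ := exists_gram_of_nonneg hh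
  have e : pairing φ h = ∑ p, ∑ q, star (∑ i, t p i q i) * ∑ j, t p j q j := by
    simp only [pairing_apply, star_sum, Finset.sum_mul_sum]
    have e (i j : Fin n) : φ (h i j) i j = ∑ p, ∑ q, star (t p i q i) * t p j q j := by
      have : φ (h i j) = _ := ht i j
      simp only [this, sum_entry, CStarMatrix.mul_apply, CStarMatrix.star_apply]
    simp only [e]
    rw [Finset.sum_congr rfl fun _ _ => Finset.sum_comm, Finset.sum_comm]
    refine Finset.sum_congr rfl fun p _ => ?_
    rw [Finset.sum_congr rfl fun _ _ => Finset.sum_comm, Finset.sum_comm]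
  rw [e]
  exact Finset.sum_nonneg fun p _ => Finset.sum_nonneg fun q _ => star_mul_self_nonneg _

/-- The entanglement witness of `φ` on the span of `b`. -/
def witness (b : κ → H) (φ : (H →L[ℂ] H) →ₗ[ℂ] Mat n) : BTensorMat H n :=
  ∑ r, ∑ s, tmul (rankOne ℂ (b s) (b r)) (φ (rankOne ℂ (b r) (b s))).transpose

theorem traceFunctional_witness (hb : Orthonormal ℂ b) (φ : (H →L[ℂ] H) →ₗ[ℂ] Mat n)
    {h : BTensorMat H n} (hh : IsSupportedOn b h) :
    traceFunctional b h (witness b φ) = pairing φ h := by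
  classical
  rw [traceFunctional_apply, pairing_apply]
  refine Finset.sum_congr rfl fun i _ => Finset.sum_congr rfl fun j _ => ?_
  conv_rhs => rw [hh.eq_sum_rankOne i j]
  simp only [map_sum, map_smul, sum_entry, CStarMatrix.smul_apply, smul_eq_mul]
  refine Finset.sum_congr rfl fun r _ => ?_
  have e : witness b φ j i (b r) = ∑ s, φ (rankOne ℂ (b r) (b s)) i j • b s := by
    simp only [witness, sum_entry, tmul, ofMatrix_entry, sum_apply, smul_apply, rankOne_apply,
      CStarMatrix.transpose_apply]
    rw [Finset.sum_eq_single r]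
    · simp [hb.1 r]
    · intro l _ hl
      simp [hb.2 hl]
    · simp
  rw [e]
  simp only [map_sum, map_smul, inner_sum, inner_smul_right, mul_comm]

/-- For orthonormal `b` this operator is the unnormalised density operator of `σ` compressed to the
span of `b`. Its quadratic form at `v` is `σ` of the positive rank-one operator of `∑ s, ⟪b s, v⟫ •
b s`. -/
theorem sum_smul_rankOne_nonneg (b : κ → H) {σ : StrongDual ℂ (H →L[ℂ] H)} (hσ : IsState σ) :
    0 ≤ ∑ r, ∑ s, σ (rankOne ℂ (b s) (b r)) • rankOne ℂ (b r) (b s) := by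
  rw [ContinuousLinearMap.nonneg_iff_isPositive, ContinuousLinearMap.isPositive_iff_complex]
  intro v
  have h : 0 ≤ σ (rankOne ℂ (∑ s, ⟪b s, v⟫_ℂ • b s) (∑ s, ⟪b s, v⟫_ℂ • b s)) :=
    hσ.1 _ (ContinuousLinearMap.nonneg_iff_isPositive _ |>.mpr (isPositive_rankOne_self _))
  have e : ⟪(∑ r, ∑ s, σ (rankOne ℂ (b s) (b r)) • rankOne ℂ (b r) (b s)) v, v⟫_ℂ =
      star (σ (rankOne ℂ (∑ s, ⟪b s, v⟫_ℂ • b s) (∑ s, ⟪b s, v⟫_ℂ • b s))) := by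
    have e : rankOne ℂ (∑ s, ⟪b s, v⟫_ℂ • b s) (∑ s, ⟪b s, v⟫_ℂ • b s) =
        ∑ r, ∑ s, (⟪b s, v⟫_ℂ * star ⟪b r, v⟫_ℂ) • rankOne ℂ (b s) (b r) := by
      ext u
      simp only [rankOne_apply, sum_inner, inner_smul_left, sum_apply, smul_apply,
        Finset.smul_sum, smul_smul, RCLike.star_def]
      rw [Finset.sum_comm]
      refine Finset.sum_congr rfl fun s _ => ?_
      rw [Finset.sum_mul, Finset.sum_smul]
      exact Finset.sum_congr rfl fun r _ => by congr 1; ring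
    rw [e]
    simp only [map_sum, map_smul, smul_eq_mul, star_sum, sum_apply, smul_apply, rankOne_apply,
      sum_inner, inner_smul_left, star_mul', RCLike.star_def, RCLike.conj_conj]
    exact Finset.sum_congr rfl fun r _ => Finset.sum_congr rfl fun s _ => by ring
  rw [e, (IsSelfAdjoint.of_nonneg h).star_eq]
  exact ⟨Complex.conj_eq_iff_re.mp (IsSelfAdjoint.of_nonneg h).star_eq,
    (Complex.nonneg_iff.mp h).1⟩

/-- On `σ ⊗ ω` the witness takes the value `ω (t (φ D))`, where `D ≥ 0` is the operator built from
`σ` in `sum_smul_rankOne_nonneg`; `φ`, `t` and `ω` all preserve positivity. -/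
theorem witness_nonneg_of_isProductState (b : κ → H) (φ : (H →L[ℂ] H) →ₚ[ℂ] Mat n)
    {η : StrongDual ℂ (BTensorMat H n)} (hη : IsProductState η) :
    0 ≤ η (witness b φ.toLinearMap) := by
  obtain ⟨σ, ω, hσ, hω, h⟩ := hη
  have e : η (witness b φ.toLinearMap) = ω (transposeMat n (φ.toLinearMap
      (∑ r, ∑ s, σ (rankOne ℂ (b s) (b r)) • rankOne ℂ (b r) (b s)))) := by
    simp only [witness, map_sum, h, map_smul, smul_eq_mul]
    rfl
  rw [e]
  exact hω.1 _ (transpose_nonneg (map_nonneg φ (sum_smul_rankOne_nonneg b hσ)))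

theorem witness_nonneg_of_isSeparable (b : κ → H) (φ : (H →L[ℂ] H) →ₚ[ℂ] Mat n)
    {η : StrongDual ℂ (BTensorMat H n)} (hη : IsSeparable η) :
    0 ≤ η (witness b φ.toLinearMap) := by
  have hc : IsClosed {η : StrongDual ℂ (BTensorMat H n) | 0 ≤ η (witness b φ.toLinearMap)} :=
    isClosed_Ici.preimage (by fun_prop : Continuous
      fun η : StrongDual ℂ (BTensorMat H n) => η (witness b φ.toLinearMap))
  refine closure_minimal (fun η hη => ?_) hc hη
  refine Submodule.span_induction (p := fun η _ => 0 ≤ η (witness b φ.toLinearMap))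
    (fun η hη => witness_nonneg_of_isProductState b φ hη) le_rfl
    (fun η η' _ _ h h' => add_nonneg h h') (fun c η _ h => ?_) hη
  exact smul_nonneg c.2 h

end Witness

/-! ### Approximation by finite-dimensional compressions. -/

section Normal

open Filter Topology

variable {H : Type*} [NormedAddCommGroup H] [InnerProductSpace ℂ H] {n : ℕ}
  {κ : Type*}

theorem tendsto_spanProj_apply (e : HilbertBasis κ ℂ H) (v : H) :
    Tendsto (fun s : Finset κ => spanProj (fun k : s => e k) v) atTop (𝓝 v) := by
  have h := e.hasSum_repr v
  rw [HasSum] at h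
  simp only [e.repr_apply_apply, SummationFilter.unconditional_filter] at h
  simpa only [spanProj_apply, Finset.sum_coe_sort _ (fun k => ⟪e k, v⟫_ℂ • e k)] using h

variable [CompleteSpace H]

/-- The projections converge strongly to the identity, so the compressed entries converge weakly;
they stay in the ball of radius `‖x i j‖`, where `φ` is weakly continuous. -/
theorem tendsto_pairing_compress (e : HilbertBasis κ ℂ H) {φ : (H →L[ℂ] H) →ₗ[ℂ] Mat n}
    (hφ : IsNormalMap φ) (x : BTensorMat H n) :
    Tendsto (fun s : Finset κ => pairing φ (compress (fun k : s => e k) x)) atTop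
      (𝓝 (pairing φ x)) := by
  simp only [pairing_apply]
  refine tendsto_finsetSum _ fun i _ => tendsto_finsetSum _ fun j _ => ?_
  have hb (s : Finset κ) : Orthonormal ℂ fun k : s => e k :=
    e.orthonormal.comp _ Subtype.val_injective
  have h1 := hφ ‖x i j‖ (ContinuousLinearMapWOT.ofCLM (x i j)) (le_refl ‖x i j‖)
  have h2 : Tendsto (fun s : Finset κ =>
      ContinuousLinearMapWOT.ofCLM (compress (fun k : s => e k) x i j)) atTop
      (𝓝 (ContinuousLinearMapWOT.ofCLM (x i j))) := by
    rw [ContinuousLinearMapWOT.tendsto_iff_forall_inner_apply_tendsto]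
    intro u v
    simp only [ContinuousLinearMapWOT.ofCLM_apply, compress_entry, mul_apply_eq_comp,
      ← inner_spanProj_left]
    exact (tendsto_spanProj_apply e v).inner
      (((x i j).continuous.tendsto u).comp (tendsto_spanProj_apply e u))
  have h3 := h1.tendsto.comp (tendsto_nhdsWithin_iff.mpr ⟨h2, .of_forall fun s => ?_⟩)
  · have hc : Continuous fun m : Mat n => m i j :=
      continuous_apply_apply (ρ := fun _ _ => ℂ) i j
    exact (hc.tendsto _).comp h3
  · have hs := norm_spanProj_le (hb s)
    calc ‖compress (fun k : s => e k) x i j‖ ≤ 1 * ‖x i j‖ * 1 := by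
          refine (norm_mul_le _ _).trans (mul_le_mul ((norm_mul_le _ _).trans ?_) hs
            (norm_nonneg _) (by positivity))
          gcongr
      _ = ‖x i j‖ := by ring

end Normal

/-- A normal nondecomposable map detects an entangled normal state with positive partial
transpose. -/
theorem exists_entangled_state_of_not_isDecomposable {H : Type*} [NormedAddCommGroup H]
    [InnerProductSpace ℂ H] [CompleteSpace H] (n : ℕ) (φ : (H →L[ℂ] H) →ₚ[ℂ] Mat n)
    (hnormal : IsNormalMap φ)
    (hnondec : ¬ IsDecomposable φ.toLinearMap) :
    ∃ (ρ : StrongDual ℂ (BTensorMat H n)) (h : BTensorMat H n),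
      IsState ρ ∧ IsNormalFunctional ρ ∧ IsDensityOperator h ρ ∧
      0 ≤ partialTransposeMat h ∧
      (∀ (w : Set H) (e : HilbertBasis w ℂ H), 0 ≤ partialTransposeOp e h) ∧
      ¬ 0 ≤ ampliate φ h ∧
      IsEntangled ρ ∧ PeresCondition ρ := by
  have hx : ∃ x : BTensorMat H n, 0 ≤ x ∧ 0 ≤ partialTransposeMat x ∧
      ¬ 0 ≤ pairing φ.toLinearMap x := by
    by_contra! hx
    exact hnondec (isDecomposable_of_pairing_nonneg φ hx)
  obtain ⟨x, hx0, hxt, hxn⟩ := hx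
  obtain ⟨w, e, -⟩ := exists_hilbertBasis ℂ H
  obtain ⟨s, hs⟩ : ∃ s : Finset w,
      ¬ 0 ≤ pairing φ.toLinearMap (compress (fun k : s => e k) x) := by
    by_contra! hs
    exact hxn (ge_of_tendsto' (tendsto_pairing_compress e hnormal x) hs)
  set b : s → H := fun k => e k with hb_def
  have hb : Orthonormal ℂ b := e.orthonormal.comp _ Subtype.val_injective
  have h0 := compress_nonneg b hx0
  have ht : 0 ≤ partialTransposeMat (compress b x) := compress_nonneg b hxt
  have hsupp := isSupportedOn_compress hb x
  obtain ⟨c, hc⟩ : ∃ c : ℝ, (c : ℂ) = traceFunctional b (compress b x) 1 := by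
    refine ⟨_, Complex.conj_eq_iff_re.mp (IsSelfAdjoint.of_nonneg ?_).star_eq⟩
    exact traceFunctional_nonneg hb hsupp h0 zero_le_one
  have hc_pos : 0 < c := by
    have hc0 : (0 : ℂ) ≤ c := hc ▸ traceFunctional_nonneg hb hsupp h0 zero_le_one
    -- If the trace were zero, the compressed element would vanish and `pairing φ` would be `0` on
    -- it, contrary to the choice of `s`.
    refine lt_of_le_of_ne (by exact_mod_cast hc0) fun hc' => hs ?_
    rw [eq_zero_of_traceFunctional_one_eq_zero hsupp h0 (by rw [← hc, ← hc', Complex.ofReal_zero]),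
      map_zero]
  set h := c⁻¹ • compress b x with h_def
  have hh0 : 0 ≤ h := smul_nonneg (inv_nonneg.mpr hc_pos.le) h0
  have hht : 0 ≤ partialTransposeMat h := smul_nonneg (inv_nonneg.mpr hc_pos.le) ht
  have hhs : IsSupportedOn b h := hsupp.smul _
  have hhn : ¬ 0 ≤ pairing φ.toLinearMap h := fun hp => hs <| by
    have e : compress b x = (c : ℂ) • h := by
      ext1 i j
      change compress b x i j = (c : ℂ) • (c⁻¹ • compress b x i j)
      rw [Complex.coe_smul, smul_inv_smul₀ hc_pos.ne']
    rw [e, map_smul]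
    exact smul_nonneg (by exact_mod_cast hc_pos.le) hp
  -- As `h ≥ 0`, it is its own absolute value, which gives the trace class condition.
  refine ⟨traceFunctional b h, h, ⟨fun y hy => traceFunctional_nonneg hb hhs hh0 hy, ?_⟩,
    isNormalFunctional_traceFunctional b h, ⟨hh0, ⟨h, hh0, ?_, traceFunctional b h 1, ?_⟩,
      hasTrace_mul hb hhs⟩, hht, fun w e => partialTransposeOp_nonneg e hht,
    fun ha => hhn (pairing_nonneg ha), fun hsep => hhn ?_, fun y hy => ?_⟩
  · rw [h_def, traceFunctional_smul, ← hc, ← Complex.ofReal_mul, inv_mul_cancel₀ hc_pos.ne',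
      Complex.ofReal_one]
  · rw [(IsSelfAdjoint.of_nonneg hh0).star_eq]
  · simpa using hasTrace_mul hb hhs 1
  · rw [← traceFunctional_witness hb φ.toLinearMap hhs]
    exact witness_nonneg_of_isSeparable b φ hsep
  · rw [traceFunctional_partialTranspose]
    exact traceFunctional_nonneg hb hhs.transpose hht hy

end SepStates

end

theorem mainTheorem6 {H : Type*} [NormedAddCommGroup H] [InnerProductSpace ℂ H] [CompleteSpace H]
    (n : ℕ) (φ : (H →L[ℂ] H) →ₚ[ℂ] SepStates.Mat n)
    (hnormal : SepStates.IsNormalMap φ)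
    (hnondec : ¬ SepStates.IsDecomposable φ.toLinearMap) :
    ∃ (ρ : StrongDual ℂ (SepStates.BTensorMat H n)) (h : SepStates.BTensorMat H n),
      SepStates.IsState ρ ∧ SepStates.IsNormalFunctional ρ ∧ SepStates.IsDensityOperator h ρ ∧
      0 ≤ SepStates.partialTransposeMat h ∧
      (∀ (w : Set H) (e : HilbertBasis w ℂ H), 0 ≤ SepStates.partialTransposeOp e h) ∧
      ¬ 0 ≤ SepStates.ampliate φ h ∧
      SepStates.IsEntangled ρ ∧ SepStates.PeresCondition ρ :=
  SepStates.exists_entangled_state_of_not_isDecomposable n φ hnormal hnondec
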